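/- Let $X$ and $Y$ be real Banach spaces and let $T:Y\to X$ be a bounded linear operator. Then $T$ is weakly compact (that is, the image under $T$ of the closed unit ball of $Y$ is relatively compact in the weak topology of $X$) if and only if, for every Lipschitz function $f:X\to\mathbb{R}$ and every $y\in Y$, the function $f\circ T$ is Fréchet differentiable at $y$ whenever $f$ is weak-Hadamard differentiable at $Ty$. Here $f:X\to\mathbb{R}$ is called weak-Hadamard differentiable at $x_0\in X$ if there is a bounded linear functional $D\in X^*$ such that \[\lim_{t\to 0}\ \sup_{u\in A}\left|\frac{f(x_0+tu)-f(x_0)}{t}-D(u)\right|=0\] for every nonempty relatively weakly compact set $A\subset X$. -/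

import Mathlib

open Filter Topology

/-- A subset `A` of a normed space is relatively weakly compact: its closure in the
weak topology is weakly compact. -/
def IsRelWeaklyCompact {X : Type*} [NormedAddCommGroup X] [NormedSpace ℝ X] (A : Set X) : Prop :=
  IsCompact (closure (toWeakSpace ℝ X '' A))

/-- A bounded linear operator is weakly compact if it sends the closed unit ball onto a
relatively weakly compact set. -/
def IsWeaklyCompactOperator {X Y : Type*} [NormedAddCommGroup X] [NormedSpace ℝ X]
    [NormedAddCommGroup Y] [NormedSpace ℝ Y] (T : Y →L[ℝ] X) : Prop :=
  IsRelWeaklyCompact (T '' Metric.closedBall (0 : Y) 1)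

/-- `f` is weak-Hadamard differentiable at `x₀` with differential `D`: for every relatively
weakly compact set `A`, `sup_{u ∈ A} |(f (x₀ + t u) - f x₀) / t - D u| → 0` as `t → 0`, `t ≠ 0`,
i.e. the difference quotients converge to `D` uniformly on `A`. -/
def HasWeakHadamardDerivAt {X : Type*} [NormedAddCommGroup X] [NormedSpace ℝ X]
    (f : X → ℝ) (D : X →L[ℝ] ℝ) (x₀ : X) : Prop :=
  ∀ A : Set X, IsRelWeaklyCompact A →
    TendstoUniformlyOn (fun (t : ℝ) (u : X) => (f (x₀ + t • u) - f x₀) / t) (fun u => D u)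
      (𝓝[≠] (0 : ℝ)) A

/-- `f` is weak-Hadamard differentiable at `x₀` (for some bounded linear differential). -/
def WeakHadamardDifferentiableAt {X : Type*} [NormedAddCommGroup X] [NormedSpace ℝ X]
    (f : X → ℝ) (x₀ : X) : Prop :=
  ∃ D : X →L[ℝ] ℝ, HasWeakHadamardDerivAt f D x₀

/-! If `T` is weakly compact, the image of the unit ball is an admissible test set, and uniform
convergence on it is Fréchet differentiability of `f ∘ T`. Conversely, suppose that image is not
relatively weakly compact. Its weak* closure in the bidual leaves `X`, which gives `T (v n) = x n`
and functionals `f m` with `f m (x n)` large for `m ≤ n` and zero for `n < m`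
(`exists_triangular_system`). By a double-limit argument, a weakly compact set comes near only
finitely many `x n` (`finite_near_of_triangular`). So the distance to the complement of small balls
about `t n • x n` has weak-Hadamard derivative `0` at `0`, yet along `t n • v n` its composition
with `T` grows linearly. -/

/-- A functional at distance more than `θ` from the span of finitely many functionals exceeds `θ` at
some point of the unit ball where all these functionals vanish. -/
theorem exists_mem_iInf_ker_lt {E ι : Type*} [NormedAddCommGroup E] [NormedSpace ℝ E] [Finite ι]
    (z : E →L[ℝ] ℝ) (L : ι → E →L[ℝ] ℝ) {θ : ℝ} (hθ : 0 ≤ θ)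
    (hz : ∀ g ∈ Submodule.span ℝ (Set.range L), θ < ‖z - g‖) :
    ∃ e : E, ‖e‖ ≤ 1 ∧ (∀ i, L i e = 0) ∧ θ < z e := by
  by_contra! hcon
  let p : Submodule ℝ E := ⨅ i, LinearMap.ker (L i).toLinearMap
  have hp : ∀ e ∈ p, ∀ i, L i e = 0 := fun e he i => by
    simpa using (Submodule.mem_iInf _).1 he i
  have hnorm : ‖z.comp p.subtypeL‖ ≤ θ := by
    refine ContinuousLinearMap.opNorm_le_of_unit_norm hθ fun e he => ?_
    have he' : ‖(e : E)‖ = 1 := he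
    rw [Real.norm_eq_abs, abs_le']
    refine ⟨hcon e he'.le (hp e e.2), ?_⟩
    have := hcon (-e) (by simp [he']) (fun i => by simp [hp e e.2 i])
    simpa using this
  -- Hahn–Banach: `z - g` kills the common kernel, so it lies in the span, at distance `‖g‖ ≤ θ`
  -- from `z`.
  obtain ⟨g, hg, hgn⟩ := exists_extension_norm_eq p (z.comp p.subtypeL)
  have hspan : (z - g).toLinearMap ∈
      Submodule.span ℝ (Set.range fun i => (L i).toLinearMap) := by
    refine mem_span_of_iInf_ker_le_ker fun e he => ?_
    have := hg ⟨e, he⟩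
    simp only [ContinuousLinearMap.comp_apply, Submodule.subtypeL_apply] at this
    simp [this]
  have hmap : Submodule.span ℝ (Set.range fun i => (L i).toLinearMap) =
      (Submodule.span ℝ (Set.range L)).map (ContinuousLinearMap.coeLM ℝ) := by
    rw [Submodule.map_span, ← Set.range_comp]
    rfl
  rw [hmap] at hspan
  obtain ⟨w, hw, hwz⟩ := hspan
  obtain rfl : w = z - g := ContinuousLinearMap.coe_injective hwz
  have := hz _ hw
  rw [sub_sub_cancel, hgn] at this
  exact absurd this hnorm.not_gt

open NormedSpace in
/-- A functional on the dual at distance more than `θ` from the space exceeds `θ` at some element of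
the dual unit ball vanishing at finitely many prescribed points. -/
theorem exists_dual_vanishing_lt {X : Type*} [NormedAddCommGroup X] [NormedSpace ℝ X]
    (z : StrongDual ℝ (StrongDual ℝ X)) {θ : ℝ} (hθ : 0 ≤ θ)
    (hz : ∀ x, θ < ‖z - inclusionInDoubleDual ℝ X x‖) (s : Finset X) :
    ∃ f : StrongDual ℝ X, ‖f‖ ≤ 1 ∧ (∀ x ∈ s, f x = 0) ∧ θ < z f := by
  have hrange : Submodule.span ℝ (Set.range fun x : s => inclusionInDoubleDual ℝ X x) ≤
      LinearMap.range (inclusionInDoubleDual ℝ X).toLinearMap := by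
    rw [Submodule.span_le]
    rintro _ ⟨x, rfl⟩
    exact ⟨x, rfl⟩
  obtain ⟨f, hf, hfs, hfz⟩ := exists_mem_iInf_ker_lt z
    (fun x : s => inclusionInDoubleDual ℝ X x) hθ (fun g hg => by
      obtain ⟨x, rfl⟩ := hrange hg
      exact hz x)
  exact ⟨f, hf, fun x hx => hfs ⟨x, hx⟩, hfz⟩

open NormedSpace in
/-- A bounded subset of a Banach space that is not relatively weakly compact contains a sequence
admitting a triangular system of functionals. -/
theorem exists_triangular_system {X : Type*} [NormedAddCommGroup X] [NormedSpace ℝ X]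
    [CompleteSpace X] {K : Set X} (hb : Bornology.IsBounded K) (hK : ¬ IsRelWeaklyCompact K) :
    ∃ θ > 0, ∃ (x : ℕ → X) (f : ℕ → StrongDual ℝ X), (∀ n, x n ∈ K) ∧ (∀ n, ‖f n‖ ≤ 1) ∧
      (∀ m n, m ≤ n → θ < f m (x n)) ∧ ∀ m n, n < m → f m (x n) = 0 := by
  have hnot : ¬ closure (inclusionInDoubleDualWeak ℝ X '' (toWeakSpace ℝ X '' K)) ⊆
      Set.range (inclusionInDoubleDualWeak ℝ X) := fun h => hK <|
    isCompact_closure_of_isBounded ℝ X _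
      (by rwa [Set.preimage_image_eq _ (toWeakSpace ℝ X).injective]) h
  obtain ⟨z, hzK, hzX⟩ := Set.not_subset.1 hnot
  set z' : StrongDual ℝ (StrongDual ℝ X) := WeakDual.toStrongDual z
  -- Completeness makes `X` norm closed in its bidual, so `z'` has positive distance from it.
  have hcl : IsClosed (Set.range (inclusionInDoubleDual ℝ X)) := by
    have h : Isometry (inclusionInDoubleDual ℝ X) := (inclusionInDoubleDualLi (E := X) ℝ).isometry
    exact h.isClosedEmbedding.isClosed_range
  have hne : z' ∉ Set.range (inclusionInDoubleDual ℝ X) := by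
    rintro ⟨x, hx⟩
    refine hzX ⟨toWeakSpace ℝ X x, ?_⟩
    exact DFunLike.ext _ _ fun f => DFunLike.congr_fun hx f
  obtain ⟨d, hd, hball⟩ := Metric.isOpen_iff.1 hcl.isOpen_compl z' hne
  have hdist : ∀ x, d / 2 < ‖z' - inclusionInDoubleDual ℝ X x‖ := fun x => by
    by_contra! hlt
    refine hball (a := inclusionInDoubleDual ℝ X x) ?_ ⟨x, rfl⟩
    exact Metric.mem_ball'.2 ((dist_eq_norm z' _).trans_lt (by linarith))
  -- Each new functional kills the earlier points and is large at `z'`; the new point of `K` then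
  -- approximates `z` weak* on all functionals chosen so far.
  obtain ⟨q, hq, hqr⟩ := exists_seq_of_forall_finset_exists
    (fun q : X × StrongDual ℝ X => q.1 ∈ K ∧ ‖q.2‖ ≤ 1 ∧ d / 2 < z' q.2 ∧ d / 2 < q.2 q.1)
    (fun q q' => q'.2 q.1 = 0 ∧ d / 2 < q.2 q'.1) (by
      classical
      intro s hs
      obtain ⟨f, hf1, hf0, hfz⟩ :=
        exists_dual_vanishing_lt z' (by positivity) hdist (s.image Prod.fst)
      have hopen : IsOpen {w : WeakDual ℝ (StrongDual ℝ X) |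
          ∀ g ∈ insert f (s.image Prod.snd), d / 2 < w g} := by
        rw [show {w : WeakDual ℝ (StrongDual ℝ X) | ∀ g ∈ insert f (s.image Prod.snd), d / 2 < w g}
          = ⋂ g ∈ insert f (s.image Prod.snd), {w | d / 2 < w g} by ext; simp]
        exact isOpen_biInter_finset fun g _ =>
          isOpen_lt continuous_const (WeakDual.eval_continuous g)
      obtain ⟨_, hw, _, ⟨x, hx, rfl⟩, rfl⟩ := mem_closure_iff.1 hzK _ hopen (by
        intro g hg
        rcases Finset.mem_insert.1 hg with rfl | hg
        · exact hfz
        · obtain ⟨q, hq, rfl⟩ := Finset.mem_image.1 hg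
          exact (hs q hq).2.2.1)
      exact ⟨(x, f), ⟨hx, hf1, hfz, hw f (Finset.mem_insert_self _ _)⟩, fun q hq =>
        ⟨hf0 _ (Finset.mem_image_of_mem _ hq),
          hw q.2 (Finset.mem_insert_of_mem (Finset.mem_image_of_mem _ hq))⟩⟩)
  refine ⟨d / 2, by positivity, fun n => (q n).1, fun n => (q n).2, fun n => (hq n).1,
    fun n => (hq n).2.1, fun m n hmn => ?_, fun m n hnm => (hqr n m hnm).1⟩
  rcases hmn.eq_or_lt with rfl | hlt
  · exact (hq m).2.2.2
  · exact (hqr m n hlt).2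

/-- Functionals evaluated at points of the weak space are weakly continuous. -/
theorem continuous_dual_comp_toWeakSpace_symm {X : Type*} [NormedAddCommGroup X] [NormedSpace ℝ X]
    (f : StrongDual ℝ X) : Continuous fun w : WeakSpace ℝ X => f ((toWeakSpace ℝ X).symm w) :=
  WeakBilin.eval_continuous (topDualPairing ℝ X).flip f

/-- If a sequence has a triangular system of functionals, only finitely many of its terms are
close to a given weakly compact set. -/
theorem finite_near_of_triangular {X : Type*} [NormedAddCommGroup X] [NormedSpace ℝ X]
    {θ ε : ℝ} (hε : 2 * ε < θ) {x : ℕ → X} {f : ℕ → StrongDual ℝ X} (hf : ∀ n, ‖f n‖ ≤ 1)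
    (hge : ∀ m n, m ≤ n → θ < f m (x n)) (hzero : ∀ m n, n < m → f m (x n) = 0)
    {C : Set (WeakSpace ℝ X)} (hC : IsCompact C) :
    {n | ∃ w : X, toWeakSpace ℝ X w ∈ C ∧ ‖w - x n‖ ≤ ε}.Finite := by
  set N := {n | ∃ w : X, toWeakSpace ℝ X w ∈ C ∧ ‖w - x n‖ ≤ ε}
  by_contra hN
  have hinf : ∃ᶠ n in atTop, n ∈ N := Nat.frequently_atTop_iff_infinite.2 hN
  have : NeBot (atTop ⊓ 𝓟 N) := frequently_mem_iff_neBot.1 hinf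
  let l : Ultrafilter ℕ := Ultrafilter.of (atTop ⊓ 𝓟 N)
  have hl : (l : Filter ℕ) ≤ atTop ⊓ 𝓟 N := Ultrafilter.of_le _
  have hlN : ∀ᶠ n in (l : Filter ℕ), n ∈ N := (le_principal_iff.1 (hl.trans inf_le_right))
  have hltop : (l : Filter ℕ) ≤ atTop := hl.trans inf_le_left
  choose! w hwC hwx using fun n (hn : n ∈ N) => hn
  obtain ⟨v, -, hv⟩ := hC.ultrafilter_le_nhds (l.map fun n => toWeakSpace ℝ X (w n))
    (le_principal_iff.2 (hlN.mono hwC))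
  obtain ⟨g, -, hg⟩ := (WeakDual.isCompact_closedBall (0 : StrongDual ℝ X) 1).ultrafilter_le_nhds
    (l.map fun n => StrongDual.toWeakDual (f n))
    (le_principal_iff.2 (Ultrafilter.mem_map.2 (univ_mem' fun n => by
      change dist (f n) 0 ≤ 1
      simpa using hf n)))
  set v' : X := (toWeakSpace ℝ X).symm v
  have hlim : ∀ h : StrongDual ℝ X, Tendsto (fun n => h (w n)) l (𝓝 (h v')) := fun h =>
    ((continuous_dual_comp_toWeakSpace_symm h).tendsto v).comp (show Tendsto _ _ _ from hv)
  have hglim : ∀ u : X, Tendsto (fun n => f n u) l (𝓝 (g u)) := fun u =>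
    ((WeakDual.eval_continuous u).tendsto g).comp (show Tendsto _ _ _ from hg)
  have hclose : ∀ m, ∀ n ∈ N, |f m (w n) - f m (x n)| ≤ ε := fun m n hn => by
    rw [← map_sub, ← Real.norm_eq_abs]
    calc ‖f m (w n - x n)‖ ≤ 1 * ‖w n - x n‖ := (f m).le_of_opNorm_le (hf m) _
      _ ≤ ε := by simpa using hwx n hn
  have hlow : ∀ m, θ - ε ≤ f m v' := fun m => by
    refine ge_of_tendsto (hlim (f m)) ?_
    filter_upwards [hlN, hltop (eventually_ge_atTop m)] with n hn hmn
    linarith [hge m n hmn, (abs_le.1 (hclose m n hn)).1]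
  have hup : ∀ n ∈ N, g (w n) ≤ ε := fun n hn => by
    refine le_of_tendsto (hglim (w n)) ?_
    filter_upwards [hltop (eventually_gt_atTop n)] with m hm
    linarith [hzero m n hm, (abs_le.1 (hclose m n hn)).2]
  -- The two iterated limits of `f m (w n)` both equal `g v'`, but one is at least `θ - ε` and the
  -- other at most `ε < θ - ε`.
  have h1 : θ - ε ≤ g v' := ge_of_tendsto (hglim v') (Eventually.of_forall hlow)
  have h2 : g v' ≤ ε := le_of_tendsto (hlim (WeakDual.toStrongDual g)) (hlN.mono hup)
  linarith

/-- A relatively weakly compact set is bounded under each functional. -/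
theorem IsRelWeaklyCompact.exists_abs_le {X : Type*} [NormedAddCommGroup X] [NormedSpace ℝ X]
    {A : Set X} (hA : IsRelWeaklyCompact A) (f : StrongDual ℝ X) :
    ∃ R > 0, ∀ u ∈ A, |f u| ≤ R := by
  obtain ⟨R, hR⟩ := IsCompact.exists_bound_of_continuousOn hA
    (continuous_dual_comp_toWeakSpace_symm f).continuousOn
  refine ⟨max R 1, by positivity, fun u hu => le_max_of_le_left ?_⟩
  simpa using hR (toWeakSpace ℝ X u) (subset_closure ⟨u, hu, rfl⟩)

/-- The scalar multiples of a relatively weakly compact set by bounded scalars lie in a weakly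
compact set. -/
theorem IsRelWeaklyCompact.exists_isCompact_smul {X : Type*} [NormedAddCommGroup X]
    [NormedSpace ℝ X] {A : Set X} (hA : IsRelWeaklyCompact A) (M : ℝ) :
    ∃ C : Set (WeakSpace ℝ X), IsCompact C ∧
      ∀ s : ℝ, |s| ≤ M → ∀ u ∈ A, toWeakSpace ℝ X (s • u) ∈ C := by
  refine ⟨_, ((isCompact_closedBall (0 : ℝ) M).prod hA).image
    (continuous_fst.smul continuous_snd), fun s hs u hu =>
      ⟨(s, toWeakSpace ℝ X u), ⟨by simpa using hs, subset_closure ⟨u, hu, rfl⟩⟩, by simp⟩⟩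

/-- The distance to the complement of a union of balls of radius `ε * t n` about `t n • x n`, with
`t n → 0`, has weak-Hadamard differential `0` at the origin if `x` has a triangular system of
functionals. -/
theorem hasWeakHadamardDerivAt_infDist_compl_iUnion_ball {X : Type*} [NormedAddCommGroup X]
    [NormedSpace ℝ X] {θ ε B : ℝ} (hε0 : 0 < ε) (hε : 2 * ε < θ) {x : ℕ → X}
    (hB : ∀ n, ‖x n‖ ≤ B) {f : ℕ → StrongDual ℝ X} (hf : ∀ n, ‖f n‖ ≤ 1)
    (hge : ∀ m n, m ≤ n → θ < f m (x n)) (hzero : ∀ m n, n < m → f m (x n) = 0)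
    {t : ℕ → ℝ} (ht : ∀ n, 0 < t n) :
    HasWeakHadamardDerivAt
      (fun v => Metric.infDist v (⋃ n, Metric.ball (t n • x n) (ε * t n))ᶜ) 0 0 := by
  set S : Set X := (⋃ n, Metric.ball (t n • x n) (ε * t n))ᶜ
  have hfle : ∀ n v, f n v ≤ ‖v‖ := fun n v => by
    simpa using (le_abs_self _).trans ((f n).le_of_opNorm_le (hf n) v)
  have h0 : (0 : X) ∈ S := by
    simp only [S, Set.mem_compl_iff, Set.mem_iUnion, Metric.mem_ball, not_exists, not_lt,
      dist_zero_left, norm_smul, Real.norm_eq_abs]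
    intro n
    rw [abs_of_pos (ht n), mul_comm]
    have := (hge n n le_rfl).trans_le (hfle n _)
    exact mul_le_mul_of_nonneg_left (by linarith) (ht n).le
  have hB0 : 0 ≤ B := (norm_nonneg _).trans (hB 0)
  intro A hA
  rw [Metric.tendstoUniformlyOn_iff]
  intro δ hδ
  -- If `r • u` lies in the `n`-th ball with quotient at least `δ`, then `δ * |r| ≤ ‖r • u‖ ≤ (B +
  -- ε) * t n`, so `|r / t n| ≤ M`. Rescaling by `t n` puts `n` in the finite set `N`.
  set M := (B + ε) / δ
  obtain ⟨C, hC, hAC⟩ := hA.exists_isCompact_smul M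
  have hfin := finite_near_of_triangular hε hf hge hzero hC
  set N := {n | ∃ w : X, toWeakSpace ℝ X w ∈ C ∧ ‖w - x n‖ ≤ ε}
  -- On the `n`-th ball `f n` exceeds `t n * (θ - ε)`, while `f n (r • u)` tends to `0` uniformly on
  -- `A`.
  have hsmall : ∀ᶠ r : ℝ in 𝓝 0, ∀ n ∈ N, ∀ u ∈ A, r • u ∉ Metric.ball (t n • x n) (ε * t n) := by
    refine (eventually_all_finite hfin).2 fun n _ => ?_
    obtain ⟨R, hR, hRA⟩ := hA.exists_abs_le (f n)
    have hpos : 0 < t n * (θ - ε) / R := by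
      have := ht n
      have : 0 < θ - ε := by linarith
      positivity
    filter_upwards [Metric.ball_mem_nhds (0 : ℝ) hpos] with r hr u hu hmem
    rw [mem_ball_zero_iff, Real.norm_eq_abs, lt_div_iff₀ hR] at hr
    rw [Metric.mem_ball, dist_comm, dist_eq_norm] at hmem
    have h1 := hfle n (t n • x n - r • u)
    simp only [map_sub, map_smul, smul_eq_mul] at h1
    have h2 : r * f n u ≤ |r| * R := by
      calc r * f n u ≤ |r * f n u| := le_abs_self _
        _ = |r| * |f n u| := abs_mul _ _
        _ ≤ |r| * R := by gcongr; exact hRA u hu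
    have h3 : t n * θ ≤ t n * f n (x n) :=
      mul_le_mul_of_nonneg_left (hge n n le_rfl).le (ht n).le
    nlinarith
  filter_upwards [hsmall.filter_mono nhdsWithin_le_nhds, self_mem_nhdsWithin] with r hr hr0 u hu
  have hr0' : 0 < |r| := abs_pos.2 hr0
  by_contra! hcon
  simp only [zero_add, Metric.infDist_zero_of_mem h0, sub_zero, zero_apply,
    dist_zero_left, Real.norm_eq_abs, abs_div, abs_of_nonneg Metric.infDist_nonneg] at hcon
  rw [le_div_iff₀ hr0'] at hcon
  have hmem : r • u ∉ S := fun hS => by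
    rw [Metric.infDist_zero_of_mem hS] at hcon
    exact absurd hcon (mul_pos hδ hr0').not_ge
  obtain ⟨n, hn⟩ := Set.mem_iUnion.1 (Set.notMem_compl_iff.1 hmem)
  have htn := ht n
  refine hr n ⟨(r / t n) • u, hAC _ ?_ u hu, ?_⟩ u hu hn
  · have h1 : Metric.infDist (r • u) S ≤ ‖r • u‖ := by
      simpa using Metric.infDist_le_dist_of_mem (x := r • u) h0
    have h2 : ‖r • u‖ ≤ ε * t n + t n * B := by
      rw [Metric.mem_ball, dist_eq_norm] at hn
      calc ‖r • u‖ = ‖(r • u - t n • x n) + t n • x n‖ := by simp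
        _ ≤ ‖r • u - t n • x n‖ + ‖t n • x n‖ := norm_add_le _ _
        _ ≤ ε * t n + t n * B := by
          rw [norm_smul, Real.norm_eq_abs, abs_of_pos htn]
          gcongr
          exact hB n
    rw [abs_div, abs_of_pos htn, div_le_div_iff₀ htn hδ]
    nlinarith
  · rw [Metric.mem_ball, dist_eq_norm] at hn
    have : (r / t n) • u - x n = (t n)⁻¹ • (r • u - t n • x n) := by
      rw [smul_sub, smul_smul, smul_smul, inv_mul_cancel₀ htn.ne', one_smul, div_eq_inv_mul]
    rw [this, norm_smul, Real.norm_eq_abs, abs_of_pos (inv_pos.2 htn), inv_mul_le_iff₀ htn]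
    linarith

/-- Composition with a weakly compact operator turns weak-Hadamard differentiability into Fréchet
differentiability. -/
theorem HasWeakHadamardDerivAt.hasFDerivAt_comp {X Y : Type*} [NormedAddCommGroup X]
    [NormedSpace ℝ X] [NormedAddCommGroup Y] [NormedSpace ℝ Y] {T : Y →L[ℝ] X}
    (hT : IsWeaklyCompactOperator T) {f : X → ℝ} {D : X →L[ℝ] ℝ} {y : Y}
    (hf : HasWeakHadamardDerivAt f D (T y)) : HasFDerivAt (f ∘ T) (D.comp T) y := by
  rw [hasFDerivAt_iff_isLittleO_nhds_zero, Asymptotics.isLittleO_iff]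
  intro c hc
  have h := Metric.tendstoUniformlyOn_iff.1 (hf _ hT) c hc
  rw [eventually_nhdsWithin_iff, Metric.eventually_nhds_iff] at h
  obtain ⟨ρ, hρ, h⟩ := h
  rw [Metric.eventually_nhds_iff]
  refine ⟨ρ, hρ, fun v hv => ?_⟩
  rcases eq_or_ne v 0 with rfl | hv0
  · simp
  have hvn : 0 < ‖v‖ := norm_pos_iff.2 hv0
  have h1 := h (y := ‖v‖) (by simpa using hv) hvn.ne' (T (‖v‖⁻¹ • v))
    ⟨_, by simp [norm_smul, hvn.ne'], rfl⟩
  rw [dist_comm, Real.dist_eq, ← map_smul, smul_smul, mul_inv_cancel₀ hvn.ne', one_smul,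
    map_smul, map_smul, smul_eq_mul, ← div_eq_inv_mul, ← sub_div, abs_div, abs_of_pos hvn,
    div_lt_iff₀ hvn] at h1
  simpa using h1.le

theorem theorem1p3 {X Y : Type*} [NormedAddCommGroup X] [NormedSpace ℝ X] [CompleteSpace X]
    [NormedAddCommGroup Y] [NormedSpace ℝ Y] [CompleteSpace Y] (T : Y →L[ℝ] X) :
    IsWeaklyCompactOperator T ↔
      ∀ f : X → ℝ, (∃ K : NNReal, LipschitzWith K f) →
        ∀ y : Y, WeakHadamardDifferentiableAt f (T y) → DifferentiableAt ℝ (f ∘ T) y := by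
  refine ⟨fun hT f _ y ⟨D, hD⟩ => (hD.hasFDerivAt_comp hT).differentiableAt, fun h => ?_⟩
  by_contra hT
  have hb : Bornology.IsBounded (T '' Metric.closedBall (0 : Y) 1) :=
    T.lipschitz.isBounded_image Metric.isBounded_closedBall
  obtain ⟨θ, hθ, x, f, hx, hf, hge, hzero⟩ := exists_triangular_system hb hT
  obtain ⟨B, hB⟩ := hb.exists_norm_le
  choose v hv hvx using hx
  obtain ⟨t, -, ht, htlim⟩ := exists_seq_strictAnti_tendsto (0 : ℝ)
  have hε : 0 < θ / 3 := by positivity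
  have hwh := hasWeakHadamardDerivAt_infDist_compl_iUnion_ball (ε := θ / 3) hε (by linarith)
    (fun n => hB _ ⟨v n, hv n, hvx n⟩) hf hge hzero ht
  set S : Set X := (⋃ n, Metric.ball (t n • x n) (θ / 3 * t n))ᶜ
  have hd := h (fun u => Metric.infDist u S) ⟨1, Metric.lipschitz_infDist_pt S⟩ 0
    ⟨0, by simpa using hwh⟩
  have h0S : (0 : X) ∈ S := by
    simp only [S, Set.mem_compl_iff, Set.mem_iUnion, Metric.mem_ball, not_exists, not_lt,
      dist_zero_left, norm_smul, Real.norm_eq_abs]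
    intro n
    have h1 := (hge n n le_rfl).le.trans ((le_abs_self _).trans ((f n).le_of_opNorm_le (hf n) _))
    rw [abs_of_pos (ht n), mul_comm]
    exact mul_le_mul_of_nonneg_left (by linarith) (ht n).le
  have h0 : ((fun u => Metric.infDist u S) ∘ T) 0 = 0 := by
    simp [Metric.infDist_zero_of_mem h0S]
  have hmin : IsLocalMin ((fun u => Metric.infDist u S) ∘ T) 0 :=
    Eventually.of_forall fun y => by rw [h0]; exact Metric.infDist_nonneg
  have hfd := hd.hasFDerivAt
  rw [hmin.fderiv_eq_zero, hasFDerivAt_iff_isLittleO_nhds_zero, Asymptotics.isLittleO_iff] at hfd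
  have hlim : Tendsto (fun n => t n • v n) atTop (𝓝 0) := by
    refine squeeze_zero_norm (fun n => ?_) htlim
    rw [norm_smul, Real.norm_eq_abs, abs_of_pos (ht n)]
    exact mul_le_of_le_one_right (ht n).le (by simpa using hv n)
  -- `θ / 6` is half the ratio `θ / 3` of ball radius to `t n`, and `‖v n‖ ≤ 1`.
  obtain ⟨n, hn⟩ := (hlim.eventually (hfd (show 0 < θ / 6 by positivity))).exists
  rw [zero_add, h0] at hn
  simp only [Function.comp_apply, map_smul, hvx, smul_zero, sub_zero,
    zero_apply, Real.norm_eq_abs, abs_of_nonneg Metric.infDist_nonneg, norm_smul, abs_of_pos (ht n)] at hn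
  have hlow : θ / 3 * t n ≤ Metric.infDist (t n • x n) S := by
    refine (Metric.le_infDist ⟨0, h0S⟩).2 fun u hu => ?_
    by_contra! hlt
    exact hu (Set.mem_iUnion.2 ⟨n, by rwa [Metric.mem_ball, dist_comm]⟩)
  have hup : θ / 6 * (t n * ‖v n‖) ≤ θ / 6 * t n := by
    gcongr
    exact mul_le_of_le_one_right (ht n).le (by simpa using hv n)
  nlinarith [mul_pos hθ (ht n)]
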